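/- Let $l\ge 1$ and let $\mathcal B_l$ be the perfect $U_q'(G_2^{(1)})$-crystal of level $l$ in its coordinate realization $b=(x_1,x_2,x_3,\bar x_3,\bar x_2,\bar x_1)\in(\mathbb Z_{\ge0}/3)^6$ with $3x_3\equiv 3\bar x_3 \pmod 2$, $x_1+x_2+\bar x_2+\bar x_1+\frac{x_3+\bar x_3}{2}\le l$ and $x_1,\bar x_1,x_2-x_3,\bar x_3-\bar x_2\in\mathbb Z$. Write $u_l=(l,0,0,0,0,0)\in\mathcal B_l$ and $1=u_1\in\mathcal B_1$. On tensor products use the rule $\tilde e_i(b\otimes b')=\tilde e_ib\otimes b'$ if $\varphi_i(b)\ge\varepsilon_i(b')$ and $b\otimes\tilde e_ib'$ otherwise, $\tilde f_i(b\otimes b')=\tilde f_ib\otimes b'$ if $\varphi_i(b)>\varepsilon_i(b')$ and $b\otimes\tilde f_ib'$ otherwise. Let $\mathcal R:\mathcal B_l\otimes\mathcal B_1\to\mathcal B_1\otimes\mathcal B_l$ be the crystal isomorphism (combinatorial $R$ matrix) and let $H:\mathcal B_l\otimes\mathcal B_1\to\mathbb Z$ be an energy function, that is, whenever $\tilde e_i(b\otimes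 b')\neq0$ and $\mathcal R(b\otimes b')=\tilde b'\otimes\tilde b$, the difference $H(\tilde e_i(b\otimes b'))-H(b\otimes b')$ is $+1$ if $i=0$, $\varphi_0(b)\ge\varepsilon_0(b')$ and $\varphi_0(\tilde b')\ge\varepsilon_0(\tilde b)$; it is $-1$ if $i=0$, $\varphi_0(b)<\varepsilon_0(b')$ and $\varphi_0(\tilde b')<\varepsilon_0(\tilde b)$; and it is $0$ otherwise. For $p=b_1\otimes\cdots\otimes b_L\in\mathcal B_1^{\otimes L}$ put $u^{(0)}=u_l$ and $\mathcal R(u^{(i-1)}\otimes b_i)=\tilde b_i\otimes u^{(i)}$ for $1\le i\le L$. If $u^{(L)}=u_l$, say that $T_l(p)$ is defined and put $T_l(p)=\tilde b_1\otimes\cdots\otimes\tilde b_L$; equivalently, $\mathcal R_{L\,L+1}\cdots\mathcal R_{12}(u_l\otimes p)=T_l(p)\otimes u_l$. Put $E_l(p)=-\sum_{i=0}^{L-1}H(u^{(i)}\otimes b_{i+1})$. Then $T_l(p)$ is defined for every $p$ that ends in sufficiently many factors $1$: there is an $N$ such that $T_l(p\otimes 1^{\otimes n})$ is defined for all $L$,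 all $p\in\mathcal B_1^{\otimes L}$ and all $n\ge N$. Moreover, for every $L$ and every $p\in\mathcal B_1^{\otimes L}$ for which $T_l(p)$ is defined: if $\tilde e_2p\ne0$, then $T_l(\tilde e_2p)$ is defined, $\tilde e_2T_l(p)=T_l(\tilde e_2p)$ (in particular $\tilde e_2T_l(p)\neq0$) and $E_l(\tilde e_2p)=E_l(p)$; if $\tilde e_2p=0$, then $\tilde e_2T_l(p)=0$. The same relations hold with $\tilde f_2$ in place of $\tilde e_2$. -/

import Mathlib

namespace G2Soliton

/-! ### Crystals, tensor products, isomorphisms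

The index set `I = {0, 1, 2}` of `G_2^{(1)}` is `Fin 3`, and the symbol `0` adjoined to a crystal
is `none`. -/

/-- The maps `e_i, f_i : B → B ∪ {0}` and `ε_i, φ_i : B → ℤ` of a `U_q'(G_2^{(1)})`-crystal
on the set `B`. -/
structure CrystalData (B : Type) where
  e : Fin 3 → B → Option B
  f : Fin 3 → B → Option B
  ε : Fin 3 → B → ℤ
  φ : Fin 3 → B → ℤ

/-- The classical weight `wt b = ∑ i, (φ_i b - ε_i b) Λ_i`, through its coefficients
`⟨h_i, wt b⟩`. -/
def CrystalData.wt {B : Type} (C : CrystalData B) (b : B) : Fin 3 → ℤ :=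
  fun i => C.φ i b - C.ε i b

/-- The tensor product of crystals; `(b, b')` stands for `b ⊗ b'`. -/
def CrystalData.tensor {B B' : Type} (C : CrystalData B) (C' : CrystalData B') :
    CrystalData (B × B') where
  e i x :=
    if C.φ i x.1 ≥ C'.ε i x.2 then (C.e i x.1).map (fun y => (y, x.2))
    else (C'.e i x.2).map (fun y => (x.1, y))
  f i x :=
    if C.φ i x.1 > C'.ε i x.2 then (C.f i x.1).map (fun y => (y, x.2))
    else (C'.f i x.2).map (fun y => (x.1, y))
  ε i x := max (C.ε i x.1) (C'.ε i x.2 - C.wt x.1 i)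
  φ i x := max (C'.φ i x.2) (C.φ i x.1 + C'.wt x.2 i)

/-- A crystal isomorphism: a bijection `B ∪ {0} → B' ∪ {0}` that sends `0` to `0` (that is,
a bijection `B → B'`), preserves `wt`, `ε_i`, `φ_i` and preserves all arrows. -/
structure CrystalIso {B B' : Type} (C : CrystalData B) (C' : CrystalData B') where
  toEquiv : B ≃ B'
  wt_eq : ∀ b, C'.wt (toEquiv b) = C.wt b
  ε_eq : ∀ i b, C'.ε i (toEquiv b) = C.ε i b
  φ_eq : ∀ i b, C'.φ i (toEquiv b) = C.φ i b
  map_f : ∀ i b b', C.f i b = some b' → C'.f i (toEquiv b) = some (toEquiv b')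
  map_e : ∀ i b b', C.f i b = some b' → C'.e i (toEquiv b') = some (toEquiv b)

/-! ### The crystal `B_l` -/

/-- Six coordinates `(x₁, x₂, x₃, x̄₃, x̄₂, x̄₁) ∈ (ℤ/3)⁶`, each stored multiplied by `3`:
`a1 = 3 x₁`, `a2 = 3 x₂`, `a3 = 3 x₃`, `b3 = 3 x̄₃`, `b2 = 3 x̄₂`, `b1 = 3 x̄₁`. -/
@[ext]
structure Coord where
  a1 : ℤ
  a2 : ℤ
  a3 : ℤ
  b3 : ℤ
  b2 : ℤ
  b1 : ℤ

/-- Membership in `B_l`: all coordinates are nonnegative, `3 x₃ ≡ 3 x̄₃ (mod 2)`,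
`x₁ + x₂ + x̄₂ + x̄₁ + (x₃ + x̄₃)/2 ≤ l` (here multiplied by `6`), and
`x₁, x̄₁, x₂ - x₃, x̄₃ - x̄₂` are integers. -/
def Coord.Mem (l : ℕ) (c : Coord) : Prop :=
  (0 ≤ c.a1 ∧ 0 ≤ c.a2 ∧ 0 ≤ c.a3 ∧ 0 ≤ c.b3 ∧ 0 ≤ c.b2 ∧ 0 ≤ c.b1) ∧
  (2 : ℤ) ∣ c.a3 - c.b3 ∧
  2 * (c.a1 + c.a2 + c.b2 + c.b1) + (c.a3 + c.b3) ≤ 6 * (l : ℤ) ∧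
  (3 : ℤ) ∣ c.a1 ∧ (3 : ℤ) ∣ c.b1 ∧ (3 : ℤ) ∣ c.a2 - c.a3 ∧ (3 : ℤ) ∣ c.b3 - c.b2

instance (l : ℕ) (c : Coord) : Decidable (c.Mem l) := by
  unfold Coord.Mem
  infer_instance

/-- The underlying set of `B_l`. -/
def B (l : ℕ) : Type := {c : Coord // c.Mem l}

/-- A tuple outside `B_l` is read as `0`. -/
def toB (l : ℕ) (c : Coord) : Option (B l) :=
  if h : c.Mem l then some ⟨c, h⟩ else none

namespace Coord

/-! All integer divisions below are exact on the elements of `B_l`. -/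

/-- `z₁ = x̄₁ - x₁` -/
def z1 (c : Coord) : ℤ := (c.b1 - c.a1) / 3

/-- `z₂ = x̄₂ - x̄₃` -/
def z2 (c : Coord) : ℤ := (c.b2 - c.b3) / 3

/-- `z₃ = x₃ - x₂` -/
def z3 (c : Coord) : ℤ := (c.a3 - c.a2) / 3

/-- `w = 3 z₄`, where `z₄ = (x̄₃ - x₃)/2` -/
def w (c : Coord) : ℤ := (c.b3 - c.a3) / 2

/-- `s(b) = x₁ + x₂ + (x₃ + x̄₃)/2 + x̄₂ + x̄₁` -/
def s (c : Coord) : ℤ := (2 * (c.a1 + c.a2 + c.b2 + c.b1) + (c.a3 + c.b3)) / 6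

/-- The maximum of the set
`A = {0, z₁, z₁+z₂, z₁+z₂+3z₄, z₁+z₂+z₃+3z₄, 2z₁+z₂+z₃+3z₄}`. -/
def maxA (c : Coord) : ℤ :=
  max 0 (max c.z1 (max (c.z1 + c.z2) (max (c.z1 + c.z2 + c.w)
    (max (c.z1 + c.z2 + c.z3 + c.w) (2 * c.z1 + c.z2 + c.z3 + c.w)))))

abbrev F1 (c : Coord) : Prop :=
  c.z1 + c.z2 + c.z3 + c.w ≤ 0 ∧ c.z1 + c.z2 + c.w ≤ 0 ∧ c.z1 + c.z2 ≤ 0 ∧ c.z1 ≤ 0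

abbrev F2 (c : Coord) : Prop :=
  c.z1 + c.z2 + c.z3 + c.w ≤ 0 ∧ c.z2 + c.w ≤ 0 ∧ c.z2 ≤ 0 ∧ 0 < c.z1

abbrev F3 (c : Coord) : Prop :=
  c.z1 + c.z3 + c.w ≤ 0 ∧ c.z3 + c.w ≤ 0 ∧ c.w ≤ 0 ∧ 0 < c.z2 ∧ 0 < c.z1 + c.z2

abbrev F4 (c : Coord) : Prop :=
  0 < c.z1 + c.z2 + c.w ∧ 0 < c.z2 + c.w ∧ 0 < c.w ∧ c.z3 ≤ 0 ∧ c.z1 + c.z3 ≤ 0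

abbrev F5 (c : Coord) : Prop :=
  0 < c.z1 + c.z2 + c.z3 + c.w ∧ 0 < c.z3 + c.w ∧ 0 < c.z3 ∧ c.z1 ≤ 0

abbrev F6 (c : Coord) : Prop :=
  0 < c.z1 + c.z2 + c.z3 + c.w ∧ 0 < c.z1 + c.z3 + c.w ∧ 0 < c.z1 + c.z3 ∧ 0 < c.z1

/-! `(E_i)` is `(F_i)` with `>` replaced by `≥` and `≤` replaced by `<`. -/

abbrev E1 (c : Coord) : Prop :=
  c.z1 + c.z2 + c.z3 + c.w < 0 ∧ c.z1 + c.z2 + c.w < 0 ∧ c.z1 + c.z2 < 0 ∧ c.z1 < 0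

abbrev E2 (c : Coord) : Prop :=
  c.z1 + c.z2 + c.z3 + c.w < 0 ∧ c.z2 + c.w < 0 ∧ c.z2 < 0 ∧ 0 ≤ c.z1

abbrev E3 (c : Coord) : Prop :=
  c.z1 + c.z3 + c.w < 0 ∧ c.z3 + c.w < 0 ∧ c.w < 0 ∧ 0 ≤ c.z2 ∧ 0 ≤ c.z1 + c.z2

abbrev E4 (c : Coord) : Prop :=
  0 ≤ c.z1 + c.z2 + c.w ∧ 0 ≤ c.z2 + c.w ∧ 0 ≤ c.w ∧ c.z3 < 0 ∧ c.z1 + c.z3 < 0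

abbrev E5 (c : Coord) : Prop :=
  0 ≤ c.z1 + c.z2 + c.z3 + c.w ∧ 0 ≤ c.z3 + c.w ∧ 0 ≤ c.z3 ∧ c.z1 < 0

abbrev E6 (c : Coord) : Prop :=
  0 ≤ c.z1 + c.z2 + c.z3 + c.w ∧ 0 ≤ c.z1 + c.z3 + c.w ∧ 0 ≤ c.z1 + c.z3 ∧ 0 ≤ c.z1

/-- The tuple with `(d1, …, d6)/3` added to the coordinates. -/
def add (c : Coord) (d1 d2 d3 d4 d5 d6 : ℤ) : Coord :=
  ⟨c.a1 + d1, c.a2 + d2, c.a3 + d3, c.b3 + d4, c.b2 + d5, c.b1 + d6⟩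

/-! The operators before it is tested whether the result lies in `B_l`. In each of them exactly one
of the listed conditions holds on `B_l`. -/

def e0 (c : Coord) : Option Coord :=
  if c.E1 then some (c.add (-3) 0 0 0 0 0)
  else if c.E2 then some (c.add 0 0 (-3) (-3) 0 3)
  else if c.E3 then
    if c.w = -1 then some (c.add 0 (-2) (-2) 4 1 0)
    else if c.w = -2 then some (c.add 0 (-1) (-4) 2 2 0)
    else some (c.add 0 0 (-6) 0 3 0)
  else if c.E4 then some (c.add 0 (-3) 0 6 0 0)
  else if c.E5 then some (c.add (-3) 0 3 3 0 0)
  else if c.E6 then some (c.add 0 0 0 0 0 3)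
  else none

def f0 (c : Coord) : Option Coord :=
  if c.F1 then some (c.add 3 0 0 0 0 0)
  else if c.F2 then some (c.add 0 0 3 3 0 (-3))
  else if c.F3 then some (c.add 0 0 6 0 (-3) 0)
  else if c.F4 then
    if c.w = 1 then some (c.add 0 1 4 (-2) (-2) 0)
    else if c.w = 2 then some (c.add 0 2 2 (-4) (-1) 0)
    else some (c.add 0 3 0 (-6) 0 0)
  else if c.F5 then some (c.add 3 0 (-3) (-3) 0 0)
  else if c.F6 then some (c.add 0 0 0 0 0 (-3))
  else none

def e1 (c : Coord) : Option Coord :=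
  if c.z2 ≥ max (-c.z3) 0 then some (c.add 0 0 0 0 3 (-3))
  else if c.z2 < 0 ∧ 0 ≤ c.z3 then some (c.add 0 0 3 (-3) 0 0)
  else if max c.z2 0 < -c.z3 then some (c.add 3 (-3) 0 0 0 0)
  else none

def f1 (c : Coord) : Option Coord :=
  if max c.z2 0 ≤ -c.z3 then some (c.add (-3) 3 0 0 0 0)
  else if c.z2 ≤ 0 ∧ 0 < c.z3 then some (c.add 0 0 (-3) 3 0 0)
  else if c.z2 > max (-c.z3) 0 then some (c.add 0 0 0 0 (-3) 3)
  else none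

def e2 (c : Coord) : Option Coord :=
  if c.w ≥ 0 then some (c.add 0 0 0 2 (-1) 0) else some (c.add 0 1 (-2) 0 0 0)

def f2 (c : Coord) : Option Coord :=
  if c.w ≤ 0 then some (c.add 0 (-1) 2 0 0 0) else some (c.add 0 0 0 (-2) 1 0)

end Coord

/-- The crystal `B_l` of `G_2^{(1)}`. -/
def crystalB (l : ℕ) : CrystalData (B l) where
  e i b := ((![Coord.e0, Coord.e1, Coord.e2] i) b.1).bind (toB l)
  f i b := ((![Coord.f0, Coord.f1, Coord.f2] i) b.1).bind (toB l)
  ε i b :=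
    ![(l : ℤ) - b.1.s + b.1.maxA - (2 * b.1.z1 + b.1.z2 + b.1.z3 + b.1.w),
      (b.1.b1 + max (b.1.b3 - b.1.b2 + max (b.1.a2 - b.1.a3) 0) 0) / 3,
      b.1.b2 + max (b.1.a3 - b.1.b3) 0 / 2] i
  φ i b :=
    ![(l : ℤ) - b.1.s + b.1.maxA,
      (b.1.a1 + max (b.1.a3 - b.1.a2 + max (b.1.b2 - b.1.b3) 0) 0) / 3,
      b.1.a2 + max (b.1.b3 - b.1.a3) 0 / 2] i

/-- The element `u_l = (l, 0, 0, 0, 0, 0)` of `B_l`. The element `1` of `B_1` is `u 1`. -/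
def u (l : ℕ) : B l :=
  ⟨⟨3 * (l : ℤ), 0, 0, 0, 0, 0⟩, by simp only [Coord.Mem]; omega⟩

/-! ### Tensor powers -/

/-- The tensor powers of a crystal, all lengths together: the list `[b₁, …, b_L]` stands for
`b₁ ⊗ ⋯ ⊗ b_L = b₁ ⊗ (b₂ ⊗ (⋯ ⊗ b_L))`, and the empty list is the only element of the trivial
crystal, on which `e_i = f_i = 0` and `ε_i = φ_i = 0`. -/
def powε {X : Type} (C : CrystalData X) (i : Fin 3) : List X → ℤ
  | [] => 0
  | b :: p => max (C.ε i b) (powε C i p - C.wt b i)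

/-- The operator `e_i` on tensor powers, by the tensor product rule. -/
def powE {X : Type} (C : CrystalData X) (i : Fin 3) : List X → Option (List X)
  | [] => none
  | b :: p =>
    if C.φ i b ≥ powε C i p then (C.e i b).map (fun b' => b' :: p)
    else (powE C i p).map (fun p' => b :: p')

/-- The operator `f_i` on tensor powers, by the tensor product rule. -/
def powF {X : Type} (C : CrystalData X) (i : Fin 3) : List X → Option (List X)
  | [] => none
  | b :: p =>
    if C.φ i b > powε C i p then (C.f i b).map (fun b' => b' :: p)
    else (powF C i p).map (fun p' => b :: p')

/-! ### Combinatorial `R`, energy function, time evolution -/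

/-- Crystal isomorphisms `B_l ⊗ B_1 → B_1 ⊗ B_l`. -/
abbrev CombR (l : ℕ) : Type :=
  CrystalIso ((crystalB l).tensor (crystalB 1)) ((crystalB 1).tensor (crystalB l))

/-- `H` is an energy function on `B_l ⊗ B_1`. With `y = R x`, `x = b ⊗ b'` and `y = b̃' ⊗ b̃`. -/
def IsEnergy {l : ℕ} (R : CombR l) (H : B l × B 1 → ℤ) : Prop :=
  ∀ (i : Fin 3) (x x' : B l × B 1), ((crystalB l).tensor (crystalB 1)).e i x = some x' →
    H x' =
      if i = 0 ∧ (crystalB l).φ 0 x.1 ≥ (crystalB 1).ε 0 x.2 ∧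
          (crystalB 1).φ 0 (R.toEquiv x).1 ≥ (crystalB l).ε 0 (R.toEquiv x).2 then H x + 1
      else if i = 0 ∧ (crystalB l).φ 0 x.1 < (crystalB 1).ε 0 x.2 ∧
          (crystalB 1).φ 0 (R.toEquiv x).1 < (crystalB l).ε 0 (R.toEquiv x).2 then H x - 1
      else H x

/-- `R_{L,L+1} ⋯ R_{23} R_{12}` applied to `v ⊗ b₁ ⊗ ⋯ ⊗ b_L`: the result
`b̃₁ ⊗ ⋯ ⊗ b̃_L ⊗ v'` is returned as `([b̃₁, …, b̃_L], v')`. -/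
def transfer {l : ℕ} (R : CombR l) : B l → List (B 1) → List (B 1) × B l
  | v, [] => ([], v)
  | v, b :: p =>
    ((R.toEquiv (v, b)).1 :: (transfer R (R.toEquiv (v, b)).2 p).1,
      (transfer R (R.toEquiv (v, b)).2 p).2)

/-- `T_l(p) = q`, that is, `R_{L,L+1} ⋯ R_{23} R_{12} (u_l ⊗ p) = q ⊗ u_l`. -/
def IsTimeEvolution {l : ℕ} (R : CombR l) (p q : List (B 1)) : Prop :=
  transfer R (u l) p = (q, u l)

/-- `-∑ H(u^{(i)} ⊗ b_{i+1})`, where `u^{(0)} = v` and `R(u^{(i)} ⊗ b_{i+1}) = b̃_{i+1} ⊗ u^{(i+1)}`. -/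
def energyFrom {l : ℕ} (R : CombR l) (H : B l × B 1 → ℤ) : B l → List (B 1) → ℤ
  | _, [] => 0
  | v, b :: p => -H (v, b) + energyFrom R H (R.toEquiv (v, b)).2 p

/-- The state energy `E_l(p)`. -/
def stateEnergy {l : ℕ} (R : CombR l) (H : B l × B 1 → ℤ) (p : List (B 1)) : ℤ :=
  energyFrom R H (u l) p

end G2Soliton

namespace G2Soliton

-- Commutation with `e_2` and `f_2` rests on one fact: `u_l` is trivial for the index 2, since
-- `ε_2(u_l) = φ_2(u_l) = 0`. By the tensor rule, `e_2` then acts on `u_l ⊗ p` and on `q ⊗ u_l`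
-- exactly as it acts on `p` and on `q`. The transfer map is a composite of copies of `R` and
-- reassociations, so it preserves `ε_2`, `φ_2` and the `e_2`-arrows (`transfer_ε_φ`,
-- `transfer_map_e`). Statements about `f_2` follow because `e_2` and `f_2` are mutually inverse,
-- and statements about vanishing because `ε_2 = 0` or `φ_2 = 0` detects it. The energy is constant
-- because `H` changes only along 0-arrows.
--
-- That `T_l` is defined after enough factors `1` is a separate argument. Among the weights of
-- `B_1`, that of `1` is the strict minimum of `⟨h_0, ·⟩`. So, by weight conservation, a carrier
-- passing a `1` loses `h_0`-weight unless `1` comes out again. The loss can occur only finitely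
-- often. After that `R(x_n ⊗ 1) = 1 ⊗ x_{n+1}` for all `n`, which forces `φ_0(x_n)` down to 0,
-- forces `ε_1(x_n) = 0`, and keeps `ε_2(x_n)` constant. If that constant is 0, then `x_n` becomes
-- `u_l`. If it is positive, `e_2` applied to the whole chain gives another such chain with smaller
-- `ε_2`, which ends in `u_l` by induction; then `x_n = f_2 u_l`, which is impossible. Finiteness of
-- `B_l` makes the number of steps uniform.

/-! ### Regular crystals and their maps, one index at a time -/

/-- The crystal `C` is regular with respect to the index `i`: the operators `e_i`, `f_i` are
mutually inverse and `ε_i`, `φ_i` measure the distance to the ends of the `i`-strings. -/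
structure CrystalData.Regular {X : Type} (C : CrystalData X) (i : Fin 3) : Prop where
  ε_nonneg : ∀ x, 0 ≤ C.ε i x
  φ_nonneg : ∀ x, 0 ≤ C.φ i x
  e_iff_f : ∀ x y, C.e i x = some y ↔ C.f i y = some x
  ε_of_e : ∀ x y, C.e i x = some y → C.ε i x = C.ε i y + 1
  φ_of_e : ∀ x y, C.e i x = some y → C.φ i y = C.φ i x + 1
  e_none : ∀ x, C.e i x = none ↔ C.ε i x = 0
  f_none : ∀ x, C.f i x = none ↔ C.φ i x = 0

theorem CrystalData.tensor_e_eq_some {X Y : Type} {C : CrystalData X} {D : CrystalData Y}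
    {i : Fin 3} {a a' : X} {b b' : Y} :
    (C.tensor D).e i (a, b) = some (a', b') ↔
      (D.ε i b ≤ C.φ i a ∧ C.e i a = some a' ∧ b = b') ∨
      (C.φ i a < D.ε i b ∧ a = a' ∧ D.e i b = some b') := by
  simp only [CrystalData.tensor, ge_iff_le]
  split_ifs with h
  · simp only [Option.map_eq_some_iff, Prod.mk.injEq]
    constructor
    · rintro ⟨y, hy, rfl, rfl⟩
      exact Or.inl ⟨h, hy, rfl⟩
    · rintro (⟨-, hy, rfl⟩ | ⟨h', -⟩)
      · exact ⟨_, hy, rfl, rfl⟩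
      · omega
  · simp only [Option.map_eq_some_iff, Prod.mk.injEq]
    constructor
    · rintro ⟨y, hy, rfl, rfl⟩
      exact Or.inr ⟨by omega, rfl, hy⟩
    · rintro (⟨h', -⟩ | ⟨-, rfl, hy⟩)
      · omega
      · exact ⟨_, hy, rfl, rfl⟩

theorem CrystalData.tensor_f_eq_some {X Y : Type} {C : CrystalData X} {D : CrystalData Y}
    {i : Fin 3} {a a' : X} {b b' : Y} :
    (C.tensor D).f i (a, b) = some (a', b') ↔
      (D.ε i b < C.φ i a ∧ C.f i a = some a' ∧ b = b') ∨
      (C.φ i a ≤ D.ε i b ∧ a = a' ∧ D.f i b = some b') := by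
  simp only [CrystalData.tensor, gt_iff_lt]
  split_ifs with h
  · simp only [Option.map_eq_some_iff, Prod.mk.injEq]
    constructor
    · rintro ⟨y, hy, rfl, rfl⟩
      exact Or.inl ⟨h, hy, rfl⟩
    · rintro (⟨-, hy, rfl⟩ | ⟨h', -⟩)
      · exact ⟨_, hy, rfl, rfl⟩
      · omega
  · simp only [Option.map_eq_some_iff, Prod.mk.injEq]
    constructor
    · rintro ⟨y, hy, rfl, rfl⟩
      exact Or.inr ⟨by omega, rfl, hy⟩
    · rintro (⟨h', -⟩ | ⟨-, rfl, hy⟩)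
      · omega
      · exact ⟨_, hy, rfl, rfl⟩

theorem CrystalData.tensor_ε {X Y : Type} (C : CrystalData X) (D : CrystalData Y)
    (i : Fin 3) (a : X) (b : Y) :
    (C.tensor D).ε i (a, b) = max (C.ε i a) (D.ε i b - (C.φ i a - C.ε i a)) := rfl

theorem CrystalData.tensor_φ {X Y : Type} (C : CrystalData X) (D : CrystalData Y)
    (i : Fin 3) (a : X) (b : Y) :
    (C.tensor D).φ i (a, b) = max (D.φ i b) (C.φ i a + (D.φ i b - D.ε i b)) := rfl

theorem CrystalData.Regular.tensor {X Y : Type} {C : CrystalData X} {D : CrystalData Y}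
    {i : Fin 3} (hC : C.Regular i) (hD : D.Regular i) : (C.tensor D).Regular i where
  ε_nonneg := fun ⟨a, b⟩ => le_max_of_le_left (hC.ε_nonneg a)
  φ_nonneg := fun ⟨a, b⟩ => le_max_of_le_left (hD.φ_nonneg b)
  e_iff_f := by
    rintro ⟨a, b⟩ ⟨a', b'⟩
    rw [CrystalData.tensor_e_eq_some, CrystalData.tensor_f_eq_some, hC.e_iff_f, hD.e_iff_f]
    constructor
    · rintro (⟨h, h1, rfl⟩ | ⟨h, rfl, h1⟩)
      · have := hC.φ_of_e _ _ ((hC.e_iff_f _ _).2 h1)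
        exact Or.inl ⟨by omega, h1, rfl⟩
      · have := hD.ε_of_e _ _ ((hD.e_iff_f _ _).2 h1)
        exact Or.inr ⟨by omega, rfl, h1⟩
    · rintro (⟨h, h1, rfl⟩ | ⟨h, rfl, h1⟩)
      · have := hC.φ_of_e _ _ ((hC.e_iff_f _ _).2 h1)
        exact Or.inl ⟨by omega, h1, rfl⟩
      · have := hD.ε_of_e _ _ ((hD.e_iff_f _ _).2 h1)
        exact Or.inr ⟨by omega, rfl, h1⟩
  ε_of_e := by
    rintro ⟨a, b⟩ ⟨a', b'⟩ h
    rw [CrystalData.tensor_ε, CrystalData.tensor_ε]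
    rcases CrystalData.tensor_e_eq_some.1 h with ⟨h, h1, rfl⟩ | ⟨h, rfl, h1⟩
    · have := hC.φ_of_e _ _ h1
      have := hC.ε_of_e _ _ h1
      omega
    · have := hD.ε_of_e _ _ h1
      omega
  φ_of_e := by
    rintro ⟨a, b⟩ ⟨a', b'⟩ h
    rw [CrystalData.tensor_φ, CrystalData.tensor_φ]
    rcases CrystalData.tensor_e_eq_some.1 h with ⟨h, h1, rfl⟩ | ⟨h, rfl, h1⟩
    · have := hC.φ_of_e _ _ h1
      omega
    · have := hD.φ_of_e _ _ h1
      have := hD.ε_of_e _ _ h1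
      omega
  e_none := by
    rintro ⟨a, b⟩
    have ha := hC.φ_nonneg a
    have ha' := hC.ε_nonneg a
    rw [CrystalData.tensor_ε]
    simp only [CrystalData.tensor, ge_iff_le]
    split_ifs with h
    · rw [Option.map_eq_none_iff, hC.e_none]
      omega
    · rw [Option.map_eq_none_iff, hD.e_none]
      omega
  f_none := by
    rintro ⟨a, b⟩
    have hb := hD.φ_nonneg b
    have hb' := hD.ε_nonneg b
    rw [CrystalData.tensor_φ]
    simp only [CrystalData.tensor, gt_iff_lt]
    split_ifs with h
    · rw [Option.map_eq_none_iff, hC.f_none]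
      omega
    · rw [Option.map_eq_none_iff, hD.f_none]
      omega

/-- A map of crystals that preserves `ε_i`, `φ_i` and the `e_i`-arrows for one index `i`. -/
structure IsStringMap {X Y : Type} (C : CrystalData X) (D : CrystalData Y) (i : Fin 3)
    (F : X → Y) : Prop where
  ε_eq : ∀ x, D.ε i (F x) = C.ε i x
  φ_eq : ∀ x, D.φ i (F x) = C.φ i x
  map_e : ∀ x x', C.e i x = some x' → D.e i (F x) = some (F x')

namespace IsStringMap

variable {X Y Z : Type} {C : CrystalData X} {D : CrystalData Y} {E : CrystalData Z}
  {i : Fin 3}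

theorem comp {F : X → Y} {G : Y → Z} (hG : IsStringMap D E i G) (hF : IsStringMap C D i F) :
    IsStringMap C E i (fun x => G (F x)) where
  ε_eq x := (hG.ε_eq _).trans (hF.ε_eq x)
  φ_eq x := (hG.φ_eq _).trans (hF.φ_eq x)
  map_e _ _ h := hG.map_e _ _ (hF.map_e _ _ h)

theorem tensor_right {F : X → Y} (hF : IsStringMap C D i F) (E : CrystalData Z) :
    IsStringMap (C.tensor E) (D.tensor E) i (fun x => (F x.1, x.2)) where
  ε_eq x := by
    rw [CrystalData.tensor_ε, hF.ε_eq, hF.φ_eq]; rfl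
  φ_eq x := by
    rw [CrystalData.tensor_φ, hF.φ_eq]; rfl
  map_e := by
    rintro ⟨a, b⟩ ⟨a', b'⟩ h
    rw [CrystalData.tensor_e_eq_some, hF.φ_eq]
    rcases CrystalData.tensor_e_eq_some.1 h with ⟨hle, h1, rfl⟩ | ⟨hlt, rfl, h1⟩
    · exact Or.inl ⟨hle, hF.map_e _ _ h1, rfl⟩
    · exact Or.inr ⟨hlt, rfl, h1⟩

variable (C D E i)

theorem assoc :
    IsStringMap ((C.tensor D).tensor E) (C.tensor (D.tensor E)) i
      (fun x => (x.1.1, (x.1.2, x.2))) where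
  ε_eq := by
    rintro ⟨⟨a, b⟩, c⟩
    simp only [CrystalData.tensor_ε, CrystalData.tensor_φ]
    omega
  φ_eq := by
    rintro ⟨⟨a, b⟩, c⟩
    simp only [CrystalData.tensor_ε, CrystalData.tensor_φ]
    omega
  map_e := by
    rintro ⟨⟨a, b⟩, c⟩ ⟨⟨a', b'⟩, c'⟩ h
    rw [CrystalData.tensor_e_eq_some, CrystalData.tensor_e_eq_some, CrystalData.tensor_φ] at h
    rw [CrystalData.tensor_e_eq_some, CrystalData.tensor_e_eq_some, CrystalData.tensor_ε]
    dsimp only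
    rcases h with ⟨h, ⟨h1, h2, rfl⟩ | ⟨h1, rfl, h2⟩, rfl⟩ | ⟨h, h1, h2⟩
    · exact Or.inl ⟨by omega, h2, rfl⟩
    · exact Or.inr ⟨by omega, rfl, Or.inl ⟨by omega, h2, rfl⟩⟩
    · obtain ⟨rfl, rfl⟩ := Prod.mk.inj h1
      exact Or.inr ⟨by omega, rfl, Or.inr ⟨by omega, rfl, h2⟩⟩

theorem assoc_symm :
    IsStringMap (C.tensor (D.tensor E)) ((C.tensor D).tensor E) i
      (fun x => ((x.1, x.2.1), x.2.2)) where
  ε_eq := fun ⟨a, b, c⟩ => ((assoc C D E i).ε_eq ((a, b), c)).symm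
  φ_eq := fun ⟨a, b, c⟩ => ((assoc C D E i).φ_eq ((a, b), c)).symm
  map_e := by
    rintro ⟨a, b, c⟩ ⟨a', b', c'⟩ h
    rw [CrystalData.tensor_e_eq_some, CrystalData.tensor_e_eq_some, CrystalData.tensor_ε] at h
    rw [CrystalData.tensor_e_eq_some, CrystalData.tensor_e_eq_some, CrystalData.tensor_φ]
    dsimp only
    rcases h with ⟨h, h1, h2⟩ | ⟨h, rfl, ⟨h1, h2, rfl⟩ | ⟨h1, rfl, h2⟩⟩
    · obtain ⟨rfl, rfl⟩ := Prod.mk.inj h2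
      exact Or.inl ⟨by omega, Or.inl ⟨by omega, h1, rfl⟩, rfl⟩
    · exact Or.inl ⟨by omega, Or.inr ⟨by omega, rfl, h2⟩, rfl⟩
    · exact Or.inr ⟨by omega, rfl, h2⟩

end IsStringMap

/-- The field `map_e` of `CrystalIso` takes an `f_i`-arrow as input; regularity converts an
`e_i`-arrow into one. -/
theorem CrystalIso.isStringMap {X Y : Type} {C : CrystalData X} {D : CrystalData Y} {i : Fin 3}
    (R : CrystalIso C D) (hC : C.Regular i) : IsStringMap C D i R.toEquiv where
  ε_eq := R.ε_eq i
  φ_eq := R.φ_eq i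
  map_e _ _ h := R.map_e i _ _ ((hC.e_iff_f _ _).1 h)

/-! ### Tensor powers as crystals -/

/-- The map `φ_i` on tensor powers. -/
def powφ {X : Type} (C : CrystalData X) (i : Fin 3) : List X → ℤ
  | [] => 0
  | b :: p => max (powφ C i p) (C.φ i b + (powφ C i p - powε C i p))

/-- The tensor powers of a crystal as a crystal. -/
def pow {X : Type} (C : CrystalData X) : CrystalData (List X) where
  e := powE C
  f := powF C
  ε := powε C
  φ := powφ C

section Pow

variable {X : Type} (C : CrystalData X) (i : Fin 3)

/-- Lists are not literally iterated products; this map carries tensor product arguments over to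
them. -/
theorem isStringMap_cons :
    IsStringMap (C.tensor (pow C)) (pow C) i (fun x => x.1 :: x.2) where
  ε_eq _ := rfl
  φ_eq _ := rfl
  map_e := by
    rintro ⟨a, p⟩ ⟨a', p'⟩ h
    change powE C i (a :: p) = some (a' :: p')
    rcases CrystalData.tensor_e_eq_some.1 h with ⟨hle, h1, rfl⟩ | ⟨hlt, rfl, h1⟩
    · simp only [powE, ge_iff_le, if_pos (show powε C i p ≤ C.φ i a from hle), h1, Option.map_some]
    · simp only [powE, ge_iff_le, if_neg (show ¬ powε C i p ≤ C.φ i a from not_le.2 hlt),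
        show powE C i p = some p' from h1, Option.map_some]

theorem pow_e_cons (b : X) (p : List X) :
    (pow C).e i (b :: p) = ((C.tensor (pow C)).e i (b, p)).map (fun x => x.1 :: x.2) := by
  change powE C i (b :: p) = _
  by_cases h : C.φ i b ≥ powε C i p <;>
    simp only [powE, CrystalData.tensor, pow, h, if_true, if_false, Option.map_map,
      Function.comp_def]

theorem pow_f_cons (b : X) (p : List X) :
    (pow C).f i (b :: p) = ((C.tensor (pow C)).f i (b, p)).map (fun x => x.1 :: x.2) := by
  change powF C i (b :: p) = _
  by_cases h : C.φ i b > powε C i p <;>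
    simp only [powF, CrystalData.tensor, pow, h, if_true, if_false, Option.map_map,
      Function.comp_def]

theorem pow_e_cons_eq_some {b : X} {p q : List X} :
    (pow C).e i (b :: p) = some q ↔
      ∃ b' p', q = b' :: p' ∧ (C.tensor (pow C)).e i (b, p) = some (b', p') := by
  rw [pow_e_cons, Option.map_eq_some_iff]
  constructor
  · rintro ⟨⟨b', p'⟩, h, rfl⟩
    exact ⟨b', p', rfl, h⟩
  · rintro ⟨b', p', rfl, h⟩
    exact ⟨(b', p'), h, rfl⟩

theorem pow_f_cons_eq_some {b : X} {p q : List X} :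
    (pow C).f i (b :: p) = some q ↔
      ∃ b' p', q = b' :: p' ∧ (C.tensor (pow C)).f i (b, p) = some (b', p') := by
  rw [pow_f_cons, Option.map_eq_some_iff]
  constructor
  · rintro ⟨⟨b', p'⟩, h, rfl⟩
    exact ⟨b', p', rfl, h⟩
  · rintro ⟨b', p', rfl, h⟩
    exact ⟨(b', p'), h, rfl⟩

theorem pow_ε_cons (b : X) (p : List X) : (pow C).ε i (b :: p) =
    max (C.ε i b) ((pow C).ε i p - (C.φ i b - C.ε i b)) := rfl

theorem pow_φ_cons (b : X) (p : List X) : (pow C).φ i (b :: p) =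
    max ((pow C).φ i p) (C.φ i b + ((pow C).φ i p - (pow C).ε i p)) := rfl

variable {C i}

theorem pow_ε_nonneg (hC : C.Regular i) : ∀ p, 0 ≤ (pow C).ε i p
  | [] => le_rfl
  | b :: _ => le_max_of_le_left (hC.ε_nonneg b)

theorem pow_φ_nonneg : ∀ p, 0 ≤ (pow C).φ i p
  | [] => le_rfl
  | _ :: p => le_max_of_le_left (pow_φ_nonneg p)

theorem pow_ε_φ_of_e (hC : C.Regular i) : ∀ p q, (pow C).e i p = some q →
    (pow C).ε i p = (pow C).ε i q + 1 ∧ (pow C).φ i q = (pow C).φ i p + 1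
  | [], _, h => by cases h
  | b :: p, q, h => by
    obtain ⟨b', p', rfl, h'⟩ := (pow_e_cons_eq_some C i).1 h
    simp only [pow_ε_cons, pow_φ_cons]
    rcases CrystalData.tensor_e_eq_some.1 h' with ⟨h, h1, rfl⟩ | ⟨h, rfl, h1⟩
    · have := hC.φ_of_e _ _ h1
      have := hC.ε_of_e _ _ h1
      omega
    · have := pow_ε_φ_of_e hC _ _ h1
      omega

theorem pow_e_iff_f (hC : C.Regular i) : ∀ p q,
    (pow C).e i p = some q ↔ (pow C).f i q = some p
  | [], [] => iff_of_false (fun h => by cases h) (fun h => by cases h)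
  | [], b :: q => iff_of_false (fun h => by cases h) (fun h => by
      obtain ⟨_, _, h, -⟩ := (pow_f_cons_eq_some C i).1 h
      cases h)
  | b :: p, [] => iff_of_false (fun h => by
      obtain ⟨_, _, h, -⟩ := (pow_e_cons_eq_some C i).1 h
      cases h) (fun h => by cases h)
  | b :: p, b' :: p' => by
    rw [pow_e_cons_eq_some, pow_f_cons_eq_some]
    constructor
    · rintro ⟨_, _, h, h'⟩
      obtain ⟨rfl, rfl⟩ := List.cons.inj h
      refine ⟨_, _, rfl, CrystalData.tensor_f_eq_some.2 ?_⟩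
      rcases CrystalData.tensor_e_eq_some.1 h' with ⟨h, h1, rfl⟩ | ⟨h, rfl, h1⟩
      · have := hC.φ_of_e _ _ h1
        exact Or.inl ⟨by omega, (hC.e_iff_f _ _).1 h1, rfl⟩
      · have := (pow_ε_φ_of_e hC _ _ h1).1
        exact Or.inr ⟨by omega, rfl, (pow_e_iff_f hC _ _).1 h1⟩
    · rintro ⟨_, _, h, h'⟩
      obtain ⟨rfl, rfl⟩ := List.cons.inj h
      refine ⟨_, _, rfl, CrystalData.tensor_e_eq_some.2 ?_⟩
      rcases CrystalData.tensor_f_eq_some.1 h' with ⟨h, h1, rfl⟩ | ⟨h, rfl, h1⟩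
      · have h2 := (hC.e_iff_f _ _).2 h1
        have := hC.φ_of_e _ _ h2
        exact Or.inl ⟨by omega, h2, rfl⟩
      · have h2 := (pow_e_iff_f hC _ _).2 h1
        have := (pow_ε_φ_of_e hC _ _ h2).1
        exact Or.inr ⟨by omega, rfl, h2⟩

theorem pow_e_none (hC : C.Regular i) : ∀ p, (pow C).e i p = none ↔ (pow C).ε i p = 0
  | [] => iff_of_true rfl rfl
  | b :: p => by
    have hb := hC.φ_nonneg b
    have hb' := hC.ε_nonneg b
    rw [pow_e_cons, Option.map_eq_none_iff, pow_ε_cons]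
    simp only [CrystalData.tensor, ge_iff_le]
    split_ifs with h
    · rw [Option.map_eq_none_iff, hC.e_none]
      omega
    · rw [Option.map_eq_none_iff, pow_e_none hC]
      omega

theorem pow_f_none (hC : C.Regular i) : ∀ p, (pow C).f i p = none ↔ (pow C).φ i p = 0
  | [] => iff_of_true rfl rfl
  | b :: p => by
    have hp := pow_φ_nonneg (C := C) (i := i) p
    have hp' := pow_ε_nonneg hC p
    rw [pow_f_cons, Option.map_eq_none_iff, pow_φ_cons]
    simp only [CrystalData.tensor, gt_iff_lt]
    split_ifs with h
    · rw [Option.map_eq_none_iff, hC.f_none]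
      omega
    · rw [Option.map_eq_none_iff, pow_f_none hC]
      omega

theorem CrystalData.Regular.pow (hC : C.Regular i) : (pow C).Regular i where
  ε_nonneg := pow_ε_nonneg hC
  φ_nonneg := pow_φ_nonneg
  e_iff_f := pow_e_iff_f hC
  ε_of_e p q h := (pow_ε_φ_of_e hC p q h).1
  φ_of_e p q h := (pow_ε_φ_of_e hC p q h).2
  e_none := pow_e_none hC
  f_none := pow_f_none hC

end Pow

/-! ### The crystal `B_l` -/

theorem B.mem {l : ℕ} (b : B l) : b.1.Mem l := b.2

theorem u_val (l : ℕ) : (u l).1 = ⟨3 * (l : ℤ), 0, 0, 0, 0, 0⟩ := rfl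

theorem toB_eq_some {l : ℕ} {c : Coord} {b : B l} : toB l c = some b ↔ c = b.1 := by
  unfold toB
  constructor
  · intro h
    split_ifs at h
    cases h
    rfl
  · rintro rfl
    exact dif_pos b.2

theorem toB_eq_none {l : ℕ} {c : Coord} : toB l c = none ↔ ¬ c.Mem l := by
  unfold toB
  split_ifs with h <;> simp [h]

theorem crystalB_ε_two {l : ℕ} (b : B l) :
    (crystalB l).ε 2 b = b.1.b2 + max (b.1.a3 - b.1.b3) 0 / 2 := rfl

theorem crystalB_φ_two {l : ℕ} (b : B l) :
    (crystalB l).φ 2 b = b.1.a2 + max (b.1.b3 - b.1.a3) 0 / 2 := rfl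

theorem crystalB_ε_one {l : ℕ} (b : B l) : (crystalB l).ε 1 b =
    (b.1.b1 + max (b.1.b3 - b.1.b2 + max (b.1.a2 - b.1.a3) 0) 0) / 3 := rfl

theorem crystalB_φ_one {l : ℕ} (b : B l) : (crystalB l).φ 1 b =
    (b.1.a1 + max (b.1.a3 - b.1.a2 + max (b.1.b2 - b.1.b3) 0) 0) / 3 := rfl

theorem crystalB_φ_zero {l : ℕ} (b : B l) :
    (crystalB l).φ 0 b = (l : ℤ) - b.1.s + b.1.maxA := rfl

theorem crystalB_ε_zero {l : ℕ} (b : B l) : (crystalB l).ε 0 b =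
    (l : ℤ) - b.1.s + b.1.maxA - (2 * b.1.z1 + b.1.z2 + b.1.z3 + b.1.w) := rfl

theorem crystalB_e_two {l : ℕ} (b : B l) : (crystalB l).e 2 b =
    if 0 ≤ b.1.w then toB l (b.1.add 0 0 0 2 (-1) 0) else toB l (b.1.add 0 1 (-2) 0 0 0) := by
  change (Coord.e2 b.1).bind (toB l) = _
  unfold Coord.e2
  split_ifs <;> rfl

theorem crystalB_f_two {l : ℕ} (b : B l) : (crystalB l).f 2 b =
    if b.1.w ≤ 0 then toB l (b.1.add 0 (-1) 2 0 0 0) else toB l (b.1.add 0 0 0 (-2) 1 0) := by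
  change (Coord.f2 b.1).bind (toB l) = _
  unfold Coord.f2
  split_ifs <;> rfl

/-- `e_2` raises `w` by 1 and `f_2` lowers it by 1, so the thresholds `w ≥ 0` and `w ≤ 0` select
mutually inverse moves. Both moves preserve the level bound and the congruences; only nonnegativity
can fail. -/
theorem crystalB_regular_two (l : ℕ) : (crystalB l).Regular 2 where
  ε_nonneg := by
    intro c
    have hc := c.mem
    simp only [Coord.Mem] at hc
    simp only [crystalB_ε_two]
    omega
  φ_nonneg := by
    intro c
    have hc := c.mem
    simp only [Coord.Mem] at hc
    simp only [crystalB_φ_two]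
    omega
  e_iff_f := by
    intro c d
    have hc := c.mem
    have hd := d.mem
    simp only [Coord.Mem] at hc hd
    rw [crystalB_e_two, crystalB_f_two]
    split_ifs <;> rw [toB_eq_some, toB_eq_some, Coord.ext_iff, Coord.ext_iff] <;>
      simp only [Coord.w, Coord.add] at * <;> omega
  ε_of_e := by
    intro c d h
    have hc := c.mem
    have hd := d.mem
    simp only [Coord.Mem] at hc hd
    rw [crystalB_e_two] at h
    simp only [crystalB_ε_two]
    split_ifs at h <;> rw [toB_eq_some, Coord.ext_iff] at h <;>
      simp only [Coord.w, Coord.add] at * <;> omega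
  φ_of_e := by
    intro c d h
    have hc := c.mem
    have hd := d.mem
    simp only [Coord.Mem] at hc hd
    rw [crystalB_e_two] at h
    simp only [crystalB_φ_two]
    split_ifs at h <;> rw [toB_eq_some, Coord.ext_iff] at h <;>
      simp only [Coord.w, Coord.add] at * <;> omega
  e_none := by
    intro c
    have hc := c.mem
    simp only [Coord.Mem] at hc
    rw [crystalB_e_two, crystalB_ε_two]
    split_ifs <;> rw [toB_eq_none] <;> simp only [Coord.Mem, Coord.w, Coord.add] at * <;> omega
  f_none := by
    intro c
    have hc := c.mem
    simp only [Coord.Mem] at hc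
    rw [crystalB_f_two, crystalB_φ_two]
    split_ifs <;> rw [toB_eq_none] <;> simp only [Coord.Mem, Coord.w, Coord.add] at * <;> omega

instance (l : ℕ) : Finite (B l) := by
  let S := Set.Icc (0 : ℤ) (6 * l)
  have : Finite S := (Set.finite_Icc _ _).to_subtype
  have key : ∀ b : B l, (b.1.a1 ∈ S ∧ b.1.a2 ∈ S ∧ b.1.a3 ∈ S) ∧
      b.1.b3 ∈ S ∧ b.1.b2 ∈ S ∧ b.1.b1 ∈ S := by
    intro c
    have hc := c.mem
    simp only [Coord.Mem] at hc
    simp only [S, Set.mem_Icc]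
    omega
  refine Finite.of_injective
    (fun b : B l => ((⟨_, (key b).1.1⟩, ⟨_, (key b).1.2.1⟩, ⟨_, (key b).1.2.2⟩,
      ⟨_, (key b).2.1⟩, ⟨_, (key b).2.2.1⟩, ⟨_, (key b).2.2.2⟩) : S × S × S × S × S × S)) ?_
  intro b c h
  simp only [Prod.mk.injEq, Subtype.mk.injEq] at h
  exact Subtype.ext (Coord.ext h.1 h.2.1 h.2.2.1 h.2.2.2.1 h.2.2.2.2.1 h.2.2.2.2.2)

-- Extremality of `u_l` and bounds on string lengths and weights

section HighestWeight

variable {l : ℕ}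

theorem ε_one_nonneg (b : B l) : 0 ≤ (crystalB l).ε 1 b := by
  have hc := b.mem
  simp only [Coord.Mem] at hc
  simp only [crystalB_ε_one]
  omega

theorem φ_one_nonneg (b : B l) : 0 ≤ (crystalB l).φ 1 b := by
  have hc := b.mem
  simp only [Coord.Mem] at hc
  simp only [crystalB_φ_one]
  omega

theorem ε_one_u : (crystalB l).ε 1 (u l) = 0 := by
  simp [crystalB_ε_one, u_val]

theorem φ_one_u : (crystalB l).φ 1 (u l) = l := by
  simp [crystalB_φ_one, u_val]

theorem ε_two_u : (crystalB l).ε 2 (u l) = 0 := by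
  simp [crystalB_ε_two, u_val]

theorem φ_two_u : (crystalB l).φ 2 (u l) = 0 := by
  simp [crystalB_φ_two, u_val]

theorem φ_zero_u : (crystalB l).φ 0 (u l) = 0 := by
  simp only [crystalB_φ_zero, u_val, Coord.s, Coord.maxA, Coord.z1, Coord.z2, Coord.z3, Coord.w]
  omega

theorem ε_zero_u : (crystalB l).ε 0 (u l) = 2 * l := by
  simp only [crystalB_ε_zero, u_val, Coord.s, Coord.maxA, Coord.z1, Coord.z2, Coord.z3, Coord.w]
  omega

/-- A classically highest weight element of `B_l` with `φ_0 = 0` is `u_l`. -/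
theorem eq_u_of_highest {b : B l} (h0 : (crystalB l).φ 0 b = 0) (h1 : (crystalB l).ε 1 b = 0)
    (h2 : (crystalB l).ε 2 b = 0) : b = u l := by
  have hc := b.mem
  -- `ε_2 = 0` gives `x̄₂ = 0` and `x₃ ≤ x̄₃`; then `ε_1 = 0` gives `x̄₁ = x̄₃ = 0` and `x₂ ≤ x₃`.
  -- Only `x₁` survives, and `φ_0 = l - x₁`.
  refine Subtype.ext (Coord.ext ?_ ?_ ?_ ?_ ?_ ?_) <;>
  · simp only [Coord.Mem] at hc
    simp only [crystalB_φ_zero, crystalB_ε_one, crystalB_ε_two, u_val, Coord.s, Coord.maxA, Coord.z1,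
      Coord.z2, Coord.z3, Coord.w] at *
    omega

/-- Among the weights of `B_1`, that of `u_1` is the only minimum of `⟨h_0, ·⟩`. -/
theorem wt_zero_ge (b : B 1) :
    -2 ≤ (crystalB 1).φ 0 b - (crystalB 1).ε 0 b ∧
    ((crystalB 1).φ 0 b - (crystalB 1).ε 0 b = -2 → b = u 1) := by
  have hc := b.mem
  simp only [Coord.Mem] at hc
  simp only [crystalB_φ_zero, crystalB_ε_zero, Coord.z1, Coord.z2, Coord.z3, Coord.w]
  -- The weight plus `2s` equals `4x̄₁ + x₂ + 3x̄₂ + (x₃ + 3x̄₃)/2 ≥ 0`, and `s ≤ 1`; equality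
  -- leaves only `x₁ = 1`.
  refine ⟨by omega, fun h => Subtype.ext (Coord.ext ?_ ?_ ?_ ?_ ?_ ?_)⟩ <;>
  · simp only [u_val]
    omega

theorem ε_zero_nonneg (b : B l) : 0 ≤ (crystalB l).ε 0 b := by
  have hc := b.mem
  simp only [Coord.Mem] at hc
  simp only [crystalB_ε_zero, Coord.s, Coord.maxA]
  omega

theorem φ_zero_nonneg (b : B l) : 0 ≤ (crystalB l).φ 0 b := by
  have hc := b.mem
  simp only [Coord.Mem] at hc
  simp only [crystalB_φ_zero, Coord.s, Coord.maxA]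
  omega

theorem ε_one_le (b : B l) : (crystalB l).ε 1 b ≤ 4 * l := by
  have hc := b.mem
  simp only [Coord.Mem] at hc
  simp only [crystalB_ε_one]
  omega

theorem neg_le_wt_zero (b : B l) :
    -(6 * l : ℤ) ≤ (crystalB l).φ 0 b - (crystalB l).ε 0 b := by
  have hc := b.mem
  simp only [Coord.Mem] at hc
  simp only [crystalB_φ_zero, crystalB_ε_zero, Coord.z1, Coord.z2, Coord.z3, Coord.w]
  omega

end HighestWeight

/-! ### The carrier reaches `u_l` -/

section Carrier

variable {l : ℕ} (R : CombR l)

/-- The carrier after it has passed one factor `1`. -/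
def carrierStep (v : B l) : B l := (R.toEquiv (v, u 1)).2

variable {R}

theorem ε_map_eq {v w : B l} {b c : B 1} (h : R.toEquiv (v, b) = (c, w)) (i : Fin 3) :
    max ((crystalB 1).ε i c)
      ((crystalB l).ε i w - ((crystalB 1).φ i c - (crystalB 1).ε i c)) =
    max ((crystalB l).ε i v)
      ((crystalB 1).ε i b - ((crystalB l).φ i v - (crystalB l).ε i v)) := by
  have := R.ε_eq i (v, b)
  rwa [h, CrystalData.tensor_ε, CrystalData.tensor_ε] at this

theorem φ_map_eq {v w : B l} {b c : B 1} (h : R.toEquiv (v, b) = (c, w)) (i : Fin 3) :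
    max ((crystalB l).φ i w)
      ((crystalB 1).φ i c + ((crystalB l).φ i w - (crystalB l).ε i w)) =
    max ((crystalB 1).φ i b)
      ((crystalB l).φ i v + ((crystalB 1).φ i b - (crystalB 1).ε i b)) := by
  have := R.φ_eq i (v, b)
  rwa [h, CrystalData.tensor_φ, CrystalData.tensor_φ] at this

theorem φ_zero_step {v w : B l} (h : R.toEquiv (v, u 1) = (u 1, w)) :
    (crystalB l).φ 0 w = max 0 ((crystalB l).φ 0 v - 2) := by
  have h1 := φ_map_eq h 0
  have h2 := ε_zero_nonneg w
  rw [φ_zero_u, ε_zero_u] at h1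
  push_cast at h1
  omega

theorem ε_one_step {v w : B l} (h : R.toEquiv (v, u 1) = (u 1, w)) :
    (crystalB l).ε 1 v = max 0 ((crystalB l).ε 1 w - 1) := by
  have h1 := ε_map_eq h 1
  have h2 := φ_one_nonneg v
  rw [φ_one_u, ε_one_u] at h1
  push_cast at h1
  omega

theorem ε_two_step {v w : B l} (h : R.toEquiv (v, u 1) = (u 1, w)) :
    (crystalB l).ε 2 w = (crystalB l).ε 2 v := by
  have h1 := ε_map_eq h 2
  have h2 := (crystalB_regular_two l).φ_nonneg v
  have h3 := (crystalB_regular_two l).ε_nonneg v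
  have h4 := (crystalB_regular_two l).ε_nonneg w
  rw [φ_two_u, ε_two_u] at h1
  omega

/-- Subtracting the `ε_0` identity from the `φ_0` identity gives conservation of weight, and
`wt_zero_ge` bounds what the outgoing factor carries away. -/
theorem wt_zero_step {v w : B l} {c : B 1} (h : R.toEquiv (v, u 1) = (c, w)) :
    (crystalB l).φ 0 w - (crystalB l).ε 0 w ≤ (crystalB l).φ 0 v - (crystalB l).ε 0 v ∧
    (c ≠ u 1 →
      (crystalB l).φ 0 w - (crystalB l).ε 0 w < (crystalB l).φ 0 v - (crystalB l).ε 0 v) := by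
  have h1 := ε_map_eq h 0
  have h2 := φ_map_eq h 0
  obtain ⟨h3, h4⟩ := wt_zero_ge c
  rw [ε_zero_u] at h1
  rw [φ_zero_u, ε_zero_u] at h2
  push_cast at h1 h2
  refine ⟨by omega, fun hc => ?_⟩
  have h5 := mt h4 hc
  omega

variable (R) in
theorem isStringMap_R :
    IsStringMap ((crystalB l).tensor (crystalB 1)) ((crystalB 1).tensor (crystalB l)) 2
      R.toEquiv :=
  R.isStringMap ((crystalB_regular_two l).tensor (crystalB_regular_two 1))

/-- The factor `1` is trivial for the index 2, so `e_2` acts on the carrier on either side of `R`.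
Hence `e_2` of a chain is again a chain. -/
theorem e_two_step {v v' w w' : B l} (h : R.toEquiv (v, u 1) = (u 1, w))
    (hv : (crystalB l).e 2 v = some v') (hw : (crystalB l).e 2 w = some w') :
    R.toEquiv (v', u 1) = (u 1, w') := by
  have h1 : ((crystalB l).tensor (crystalB 1)).e 2 (v, u 1) = some (v', u 1) := by
    refine CrystalData.tensor_e_eq_some.2 (Or.inl ⟨?_, hv, rfl⟩)
    rw [ε_two_u]
    exact (crystalB_regular_two l).φ_nonneg v
  have h2 : ((crystalB 1).tensor (crystalB l)).e 2 (u 1, w) = some (u 1, w') := by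
    refine CrystalData.tensor_e_eq_some.2 (Or.inr ⟨?_, rfl, hw⟩)
    have := (crystalB_regular_two l).ε_of_e _ _ hw
    have := (crystalB_regular_two l).ε_nonneg w'
    rw [φ_two_u]
    omega
  have h3 := (isStringMap_R R).map_e _ _ h1
  rw [h, h2] at h3
  exact (Option.some_inj.1 h3).symm

/-- By `ε_one_step`, a positive `ε_1` grows by 1 at every step, against the bound `4l`. -/
theorem ε_one_eq_zero_of_chain {x : ℕ → B l}
    (hx : ∀ n, R.toEquiv (x n, u 1) = (u 1, x (n + 1))) (m : ℕ) :
    (crystalB l).ε 1 (x m) = 0 := by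
  by_contra h0
  have h1 := ε_one_nonneg (x m)
  have key : ∀ k : ℕ, (k : ℤ) < (crystalB l).ε 1 (x (m + k)) := by
    intro k
    induction k with
    | zero => simpa using lt_of_le_of_ne h1 (Ne.symm h0)
    | succ k ih =>
      have := ε_one_step (hx (m + k))
      rw [← add_assoc]
      push_cast
      omega
  have h2 := key (4 * l)
  have h3 := ε_one_le (x (m + 4 * l))
  push_cast at h2
  omega

theorem φ_zero_of_chain {x : ℕ → B l}
    (hx : ∀ n, R.toEquiv (x n, u 1) = (u 1, x (n + 1))) :
    ∃ N, ∀ n, N ≤ n → (crystalB l).φ 0 (x n) = 0 := by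
  have key : ∀ n : ℕ, (crystalB l).φ 0 (x n) ≤ max 0 ((crystalB l).φ 0 (x 0) - n) := by
    intro n
    induction n with
    | zero => simp
    | succ n ih =>
      have := φ_zero_step (hx n)
      push_cast
      omega
  -- Each step lowers `φ_0` by 2 until it reaches 0; counting 1 per step suffices.
  refine ⟨((crystalB l).φ 0 (x 0)).toNat, fun n hn => ?_⟩
  have h1 := key n
  have h2 := φ_zero_nonneg (x n)
  omega

/-- If a carrier passes factors `1` for ever without changing them, it ends in `u_l`. -/
theorem eventually_eq_u_of_chain (c : ℕ) : ∀ x : ℕ → B l,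
    (∀ n, R.toEquiv (x n, u 1) = (u 1, x (n + 1))) → (crystalB l).ε 2 (x 0) = c →
    ∃ N, ∀ n, N ≤ n → x n = u l := by
  induction c with
  | zero =>
    intro x hx hc
    have h2 : ∀ n, (crystalB l).ε 2 (x n) = 0 := by
      intro n
      induction n with
      | zero => exact hc
      | succ n ih => rw [ε_two_step (hx n), ih]
    obtain ⟨N, hN⟩ := φ_zero_of_chain hx
    exact ⟨N, fun n hn => eq_u_of_highest (hN n hn) (ε_one_eq_zero_of_chain hx n) (h2 n)⟩
  | succ c ih =>
    intro x hx hc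
    have h2 : ∀ n, (crystalB l).ε 2 (x n) = c + 1 := by
      intro n
      induction n with
      | zero => exact_mod_cast hc
      | succ n ih => rw [ε_two_step (hx n), ih]
    have hreg := crystalB_regular_two l
    have hy : ∀ n, ∃ y, (crystalB l).e 2 (x n) = some y := by
      intro n
      rw [← Option.ne_none_iff_exists', Ne, hreg.e_none, h2]
      omega
    choose y hy using hy
    obtain ⟨N, hN⟩ := ih y (fun n => e_two_step (hx n) (hy n) (hy (n + 1))) (by
      have := hreg.ε_of_e _ _ (hy 0)
      rw [h2] at this
      omega)
    -- Here `e_2 (x N) = u_l` would make `x N` equal to `f_2 u_l`, which is 0.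
    have h3 := (hreg.e_iff_f _ _).1 (hy N)
    rw [hN N le_rfl, (hreg.f_none _).2 φ_two_u] at h3
    cases h3

variable (R)

/-- Induction on a bound for the `h_0`-weight, shifted by `6l` to be nonnegative. Either every
emitted factor is `1` and the carriers form a chain, or some step lowers the weight strictly. -/
theorem eventually_iterate_eq_u (k : ℕ) : ∀ v : B l,
    (crystalB l).φ 0 v - (crystalB l).ε 0 v + 6 * l < k →
    ∃ N, ∀ n, N ≤ n → (carrierStep R)^[n] v = u l := by
  induction k with
  | zero =>
    intro v hv
    have := neg_le_wt_zero v
    push_cast at hv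
    omega
  | succ k ih =>
    intro v hv
    by_cases hfix : ∀ n, (R.toEquiv ((carrierStep R)^[n] v, u 1)).1 = u 1
    · refine eventually_eq_u_of_chain (R := R) ((crystalB l).ε 2 v).toNat
        (fun n => (carrierStep R)^[n] v) (fun n => ?_) ?_
      · rw [Function.iterate_succ_apply']
        exact Prod.ext (hfix n) rfl
      · have := (crystalB_regular_two l).ε_nonneg v
        simp only [Function.iterate_zero, id_eq]
        omega
    · push Not at hfix
      obtain ⟨m, hm⟩ := hfix
      have hle : ∀ n, (crystalB l).φ 0 ((carrierStep R)^[n] v) -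
          (crystalB l).ε 0 ((carrierStep R)^[n] v) ≤
          (crystalB l).φ 0 v - (crystalB l).ε 0 v := by
        intro n
        induction n with
        | zero => exact le_rfl
        | succ n ihn =>
          rw [Function.iterate_succ_apply']
          exact (wt_zero_step (R := R) (c := (R.toEquiv (_, u 1)).1) rfl).1.trans ihn
      have hlt := (wt_zero_step (R := R) (w := carrierStep R ((carrierStep R)^[m] v)) rfl).2 hm
      have hm' := hle m
      obtain ⟨N, hN⟩ := ih (carrierStep R ((carrierStep R)^[m] v)) (by
        push_cast at hv
        omega)
      refine ⟨N + (m + 1), fun n hn => ?_⟩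
      obtain ⟨d, rfl⟩ := Nat.exists_eq_add_of_le hn
      rw [show N + (m + 1) + d = (N + d) + (m + 1) by omega, Function.iterate_add_apply,
        Function.iterate_succ_apply']
      exact hN _ (by omega)

theorem exists_uniform_iterate_eq_u :
    ∃ N, ∀ n, N ≤ n → ∀ v : B l, (carrierStep R)^[n] v = u l := by
  have h : ∀ v : B l, ∃ N, ∀ n, N ≤ n → (carrierStep R)^[n] v = u l := fun v =>
    eventually_iterate_eq_u R
      ((crystalB l).φ 0 v - (crystalB l).ε 0 v + 6 * l + 1).toNat v (by omega)
  choose N hN using h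
  obtain ⟨M, hM⟩ := (Set.finite_range N).bddAbove
  exact ⟨M, fun n hn v => hN v n ((hM ⟨v, rfl⟩).trans hn)⟩

theorem transfer_append_snd (p q : List (B 1)) : ∀ v : B l,
    (transfer R v (p ++ q)).2 = (transfer R (transfer R v p).2 q).2 := by
  induction p with
  | nil => exact fun _ => rfl
  | cons b p ih => exact fun v => ih _

theorem transfer_replicate_snd (n : ℕ) : ∀ v : B l,
    (transfer R v (List.replicate n (u 1))).2 = (carrierStep R)^[n] v := by
  induction n with
  | zero => exact fun _ => rfl
  | succ n ih => exact fun v => ih _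

/-! ### The transfer map commutes with `e_2` -/

theorem e_cons_transfer {v v' : B l} {b : B 1} {p q : List (B 1)}
    (h : ((crystalB l).tensor (pow (crystalB 1))).e 2 (v, b :: p) = some (v', q)) :
    ∃ b' p', q = b' :: p' ∧ (((crystalB l).tensor (crystalB 1)).tensor (pow (crystalB 1))).e 2
      ((v, b), p) = some ((v', b'), p') := by
  rcases CrystalData.tensor_e_eq_some.1 h with ⟨h1, h2, rfl⟩ | ⟨h1, rfl, h2⟩
  · exact ⟨b, p, rfl, (IsStringMap.assoc_symm _ _ _ _).map_e (v, b, p) (v', b, p)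
      (CrystalData.tensor_e_eq_some.2 (Or.inl ⟨h1, h2, rfl⟩))⟩
  · obtain ⟨b', p', rfl, h3⟩ := (pow_e_cons_eq_some _ _).1 h2
    exact ⟨b', p', rfl, (IsStringMap.assoc_symm _ _ _ _).map_e (v, b, p) (v, b', p')
      (CrystalData.tensor_e_eq_some.2 (Or.inr ⟨h1, rfl, h3⟩))⟩

theorem R_tensor_map_e {v v' : B l} {b b' : B 1} {p p' : List (B 1)}
    (h : (((crystalB l).tensor (crystalB 1)).tensor (pow (crystalB 1))).e 2
      ((v, b), p) = some ((v', b'), p')) :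
    ((crystalB 1).tensor ((crystalB l).tensor (pow (crystalB 1)))).e 2
      ((R.toEquiv (v, b)).1, (R.toEquiv (v, b)).2, p) =
      some ((R.toEquiv (v', b')).1, (R.toEquiv (v', b')).2, p') :=
  ((IsStringMap.assoc _ _ _ _).comp ((isStringMap_R R).tensor_right (pow (crystalB 1)))).map_e
    ((v, b), p) ((v', b'), p') h

/-- Needed before the arrows: the tensor rule compares `φ_2` of the first emitted factor with `ε_2`
of everything to its right, so that `ε_2` must be known to survive the rest of the transfer. -/
theorem transfer_ε_φ (p : List (B 1)) : ∀ v : B l,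
    ((pow (crystalB 1)).tensor (crystalB l)).ε 2 (transfer R v p) =
      ((crystalB l).tensor (pow (crystalB 1))).ε 2 (v, p) ∧
    ((pow (crystalB 1)).tensor (crystalB l)).φ 2 (transfer R v p) =
      ((crystalB l).tensor (pow (crystalB 1))).φ 2 (v, p) := by
  induction p with
  | nil =>
    intro v
    have h1 := (crystalB_regular_two l).ε_nonneg v
    have h2 := (crystalB_regular_two l).φ_nonneg v
    have h3 : (pow (crystalB 1)).ε 2 [] = 0 := rfl
    have h4 : (pow (crystalB 1)).φ 2 [] = 0 := rfl
    simp only [transfer, CrystalData.tensor_ε, CrystalData.tensor_φ, h3, h4]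
    omega
  | cons b p ih =>
    intro v
    have ih := ih (R.toEquiv (v, b)).2
    have hR := (IsStringMap.assoc (crystalB 1) (crystalB l) (pow (crystalB 1)) 2).comp
      ((isStringMap_R R).tensor_right (pow (crystalB 1)))
    have hl := IsStringMap.assoc (crystalB l) (crystalB 1) (pow (crystalB 1)) 2
    have hr := ((isStringMap_cons (crystalB 1) 2).tensor_right (crystalB l)).comp
      (IsStringMap.assoc_symm (crystalB 1) (pow (crystalB 1)) (crystalB l) 2)
    constructor
    · refine (hr.ε_eq ((R.toEquiv (v, b)).1, transfer R (R.toEquiv (v, b)).2 p)).trans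
        (Eq.trans ?_ ((hR.ε_eq ((v, b), p)).trans (hl.ε_eq ((v, b), p)).symm))
      change max _ (((pow (crystalB 1)).tensor (crystalB l)).ε 2
        (transfer R (R.toEquiv (v, b)).2 p) - _) = max _ (((crystalB l).tensor _).ε 2 _ - _)
      rw [ih.1]
    · refine (hr.φ_eq ((R.toEquiv (v, b)).1, transfer R (R.toEquiv (v, b)).2 p)).trans
        (Eq.trans ?_ ((hR.φ_eq ((v, b), p)).trans (hl.φ_eq ((v, b), p)).symm))
      change max (((pow (crystalB 1)).tensor (crystalB l)).φ 2
        (transfer R (R.toEquiv (v, b)).2 p)) (_ + (((pow (crystalB 1)).tensor (crystalB l)).φ 2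
        (transfer R (R.toEquiv (v, b)).2 p) - ((pow (crystalB 1)).tensor (crystalB l)).ε 2
        (transfer R (R.toEquiv (v, b)).2 p))) = max (((crystalB l).tensor _).φ 2 _)
        (_ + (((crystalB l).tensor _).φ 2 _ - ((crystalB l).tensor _).ε 2 _))
      rw [ih.1, ih.2]

theorem transfer_map_e (p : List (B 1)) : ∀ (v v' : B l) (q : List (B 1)),
    ((crystalB l).tensor (pow (crystalB 1))).e 2 (v, p) = some (v', q) →
    ((pow (crystalB 1)).tensor (crystalB l)).e 2 (transfer R v p) =
      some (transfer R v' q) := by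
  induction p with
  | nil =>
    intro v v' q h
    rcases CrystalData.tensor_e_eq_some.1 h with ⟨h1, h2, rfl⟩ | ⟨h1, rfl, h2⟩
    · refine CrystalData.tensor_e_eq_some.2 (Or.inr ⟨?_, rfl, h2⟩)
      have h3 := (crystalB_regular_two l).ε_of_e _ _ h2
      have h4 := (crystalB_regular_two l).ε_nonneg v'
      change (0 : ℤ) < _
      omega
    · cases h2
  | cons b p ih =>
    intro v v' q h
    obtain ⟨b', p', rfl, h'⟩ := e_cons_transfer h
    have hr := ((isStringMap_cons (crystalB 1) 2).tensor_right (crystalB l)).comp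
      (IsStringMap.assoc_symm (crystalB 1) (pow (crystalB 1)) (crystalB l) 2)
    refine hr.map_e ((R.toEquiv (v, b)).1, transfer R (R.toEquiv (v, b)).2 p)
      ((R.toEquiv (v', b')).1, transfer R (R.toEquiv (v', b')).2 p') ?_
    -- After one `R`, `e_2` acts either on the emitted factor, leaving the remaining transfer
    -- untouched, or on the new carrier and the tail, where the induction hypothesis applies.
    rw [CrystalData.tensor_e_eq_some, (transfer_ε_φ R p _).1]
    rcases CrystalData.tensor_e_eq_some.1 (R_tensor_map_e R h') with
      ⟨h1, h2, h3⟩ | ⟨h1, h2, h3⟩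
    · obtain ⟨h3, h4⟩ := Prod.mk.inj h3
      exact Or.inl ⟨h1, h2, by rw [h3, h4]⟩
    · exact Or.inr ⟨h1, h2, ih _ _ _ h3⟩

/-- At each crossing the pair entering `R` is either unchanged or moved by one `e_2`-arrow, and `H`
is constant along such arrows. -/
theorem energyFrom_of_e {H : B l × B 1 → ℤ} (hH : IsEnergy R H) (p : List (B 1)) :
    ∀ (v v' : B l) (q : List (B 1)),
    ((crystalB l).tensor (pow (crystalB 1))).e 2 (v, p) = some (v', q) →
    energyFrom R H v' q = energyFrom R H v p := by
  induction p with
  | nil =>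
    intro v v' q h
    rcases CrystalData.tensor_e_eq_some.1 h with ⟨-, -, rfl⟩ | ⟨-, -, h2⟩
    · rfl
    · cases h2
  | cons b p ih =>
    intro v v' q h
    obtain ⟨b', p', rfl, h'⟩ := e_cons_transfer h
    have hhead : H (v', b') = H (v, b) := by
      rcases CrystalData.tensor_e_eq_some.1 h' with ⟨-, h1, -⟩ | ⟨-, h1, -⟩
      · have := hH 2 _ _ h1
        rwa [if_neg (fun h => absurd h.1 (by decide)),
          if_neg (fun h => absurd h.1 (by decide))] at this
      · rw [h1]
    have htail : energyFrom R H (R.toEquiv (v', b')).2 p' =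
        energyFrom R H (R.toEquiv (v, b)).2 p := by
      rcases CrystalData.tensor_e_eq_some.1 (R_tensor_map_e R h') with
        ⟨-, -, h1⟩ | ⟨-, -, h1⟩
      · obtain ⟨h1, h2⟩ := Prod.mk.inj h1
        rw [h1, h2]
      · exact ih _ _ _ h1
    simp only [energyFrom, hhead, htail]

end Carrier

-- Restriction of the transfer map to carriers that start and end in `u_l`

section TimeEvolution

variable {l : ℕ} {R : CombR l} {p q : List (B 1)}

theorem e_u_tensor {p' : List (B 1)} (h : (pow (crystalB 1)).e 2 p = some p') :
    ((crystalB l).tensor (pow (crystalB 1))).e 2 (u l, p) = some (u l, p') := by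
  have hreg := (crystalB_regular_two 1).pow
  refine CrystalData.tensor_e_eq_some.2 (Or.inr ⟨?_, rfl, h⟩)
  have h1 := hreg.ε_of_e _ _ h
  have h2 := hreg.ε_nonneg p'
  rw [φ_two_u]
  omega

theorem IsTimeEvolution.map_e (h : IsTimeEvolution R p q) {p' : List (B 1)}
    (hp : (pow (crystalB 1)).e 2 p = some p') :
    ∃ q', (pow (crystalB 1)).e 2 q = some q' ∧ IsTimeEvolution R p' q' := by
  have h1 := transfer_map_e R p _ _ _ (e_u_tensor hp)
  rw [h] at h1
  rcases (CrystalData.tensor_e_eq_some (a' := (transfer R (u l) p').1)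
    (b' := (transfer R (u l) p').2)).1 h1 with ⟨-, h2, h3⟩ | ⟨h2, -⟩
  · exact ⟨_, h2, Prod.ext rfl h3.symm⟩
  -- `e_2` cannot act on the right factor `u_l`: that would need `φ_2(q) < ε_2(u_l) = 0`.
  · have := ((crystalB_regular_two 1).pow).φ_nonneg q
    rw [ε_two_u] at h2
    omega

theorem IsTimeEvolution.map_f (h : IsTimeEvolution R p q) {p' : List (B 1)}
    (hp : (pow (crystalB 1)).f 2 p = some p') :
    ∃ q', (pow (crystalB 1)).f 2 q = some q' ∧ IsTimeEvolution R p' q' := by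
  have hreg := (crystalB_regular_two 1).pow
  -- The `e_2`-arrow from `p'` to `p` is transferred and then inverted. This also shows that the
  -- carrier of `p'` returns to `u_l`, because `f_2 u_l = 0`.
  have h1 := transfer_map_e R p' _ _ _ (e_u_tensor ((hreg.e_iff_f _ _).2 hp))
  rw [h, (hreg.tensor (crystalB_regular_two l)).e_iff_f] at h1
  rcases (CrystalData.tensor_f_eq_some (a' := (transfer R (u l) p').1)
    (b' := (transfer R (u l) p').2)).1 h1 with ⟨-, h2, h3⟩ | ⟨-, -, h2⟩
  · exact ⟨_, h2, Prod.ext rfl h3.symm⟩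
  · rw [((crystalB_regular_two l).f_none _).2 φ_two_u] at h2
    cases h2

theorem IsTimeEvolution.ε_φ_eq (h : IsTimeEvolution R p q) :
    (pow (crystalB 1)).ε 2 q = (pow (crystalB 1)).ε 2 p ∧
    (pow (crystalB 1)).φ 2 q = (pow (crystalB 1)).φ 2 p := by
  have hreg := (crystalB_regular_two 1).pow
  obtain ⟨h1, h2⟩ := transfer_ε_φ R p (u l)
  have hp := hreg.ε_nonneg p
  have hq := hreg.ε_nonneg q
  have hp' := hreg.φ_nonneg p
  have hq' := hreg.φ_nonneg q
  rw [h] at h1 h2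
  simp only [CrystalData.tensor_ε, CrystalData.tensor_φ, ε_two_u, φ_two_u] at h1 h2
  omega

end TimeEvolution

end G2Soliton

theorem proposition9 (l : ℕ) (hl : 0 < l) (R : G2Soliton.CombR l)
    (H : G2Soliton.B l × G2Soliton.B 1 → ℤ) (hH : G2Soliton.IsEnergy R H) :
    -- `T_l` is defined on all `b₁ ⊗ ⋯ ⊗ b_L` that end in sufficiently many factors `1`
    (∃ N : ℕ, ∀ p : List (G2Soliton.B 1), ∀ n : ℕ, N ≤ n →
      ∃ q, G2Soliton.IsTimeEvolution R (p ++ List.replicate n (G2Soliton.u 1)) q) ∧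
    -- the relations, for every `p` on which `T_l` is defined
    (∀ p q : List (G2Soliton.B 1), G2Soliton.IsTimeEvolution R p q →
      (∀ p', G2Soliton.powE (G2Soliton.crystalB 1) 2 p = some p' →
        (∃ q', G2Soliton.powE (G2Soliton.crystalB 1) 2 q = some q' ∧
          G2Soliton.IsTimeEvolution R p' q') ∧
        G2Soliton.stateEnergy R H p' = G2Soliton.stateEnergy R H p) ∧
      (G2Soliton.powE (G2Soliton.crystalB 1) 2 p = none →
        G2Soliton.powE (G2Soliton.crystalB 1) 2 q = none) ∧
      (∀ p', G2Soliton.powF (G2Soliton.crystalB 1) 2 p = some p' →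
        (∃ q', G2Soliton.powF (G2Soliton.crystalB 1) 2 q = some q' ∧
          G2Soliton.IsTimeEvolution R p' q') ∧
        G2Soliton.stateEnergy R H p' = G2Soliton.stateEnergy R H p) ∧
      (G2Soliton.powF (G2Soliton.crystalB 1) 2 p = none →
        G2Soliton.powF (G2Soliton.crystalB 1) 2 q = none)) := by
  have hreg := (G2Soliton.crystalB_regular_two 1).pow
  refine ⟨?_, fun p q hpq => ⟨fun p' hp => ⟨hpq.map_e hp, ?_⟩, fun hp => ?_,
    fun p' hp => ⟨hpq.map_f hp, ?_⟩, fun hp => ?_⟩⟩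
  · obtain ⟨N, hN⟩ := G2Soliton.exists_uniform_iterate_eq_u R
    refine ⟨N, fun p n hn => ⟨_, Prod.ext rfl ?_⟩⟩
    rw [G2Soliton.transfer_append_snd, G2Soliton.transfer_replicate_snd, hN n hn]
  · exact G2Soliton.energyFrom_of_e R hH p _ _ _ (G2Soliton.e_u_tensor hp)
  · exact (hreg.e_none q).2 (hpq.ε_φ_eq.1.trans ((hreg.e_none p).1 hp))
  · exact (G2Soliton.energyFrom_of_e R hH p' _ _ _ (G2Soliton.e_u_tensor ((hreg.e_iff_f _ _).2 hp))).symm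
  · exact (hreg.f_none q).2 (hpq.ε_φ_eq.2.trans ((hreg.f_none p).1 hp))
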